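/- A \emph{tree MDP} (T-MDP) has finite sets $\mathcal S$ (non-terminal states, including a start state $s_1$), $\Sigma$ (terminal states) and $\mathcal A$ (actions, $|\mathcal A|\ge 2$), a horizon $\mathcal H\ge 1$, transition probabilities $p(s,a,\cdot)$ on $\mathcal S\cup\Sigma$, known real rewards $r(s,a,s')$ and a discount factor $\gamma\in[0,1]$. Every state $s'\ne s_1$ has exactly one parent $s\in\mathcal S$, from which it is reachable by exactly one action $a$; transitions lead only from states to their children; $s_1$ has level $1$, a non-terminal child is one level above its parent, and all levels of non-terminal states are at most $\mathcal H$. For $\sigma\in\Sigma$ with path $s_1,a_1,\dots,s_m,a_m,s_{m+1}=\sigma$, put $\rho(\sigma)=\sum_{i=1}^m\gamma^{i-1}r(s_i,a_i,s_{i+1})$, and assume $\rho(\sigma)\in[0,1]$ for all $\sigma \in \Sigma$. Let $\Pi$ be the set of deterministic policies $\pi:\mathcal S\to\mathcal A$. The values $V^\pi$ satisfy $V^\pi(s)=\sum_{s'}p(s,\pi(s),s')\,(r(s,\pi(s),s')+\gamma V^\pi(s'))$ with $V^\pi=0$ on $\Sigma$, and $V(\pi)=V^\pi(s_1)$. A policy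 $\pi^\star$ is optimal if at every $s\in\mathcal S$ the action $\pi^\star(s)$ maximises $a\mapsto\sum_{s'}p(s,a,s')\,(r(s,a,s')+\gamma V^{\pi^\star}(s'))$. A policy $\pi$ is consistent with $\sigma$ if $\pi(s_i)=a_i$ for all $i\le m$; let $X(\pi)$ be the set of terminal states with which $\pi$ is consistent. Playing $\pi$ for one episode means starting at $s_1$ and following $\pi$, with fresh transitions sampled from $p$, until a terminal state is reached. After a number of episodes let $n(\sigma)$ be the number of episodes whose policy was consistent with $\sigma$, $n_+(\sigma)$ the number of episodes that reached $\sigma$, and $$n(\pi)=\min_{\sigma\in X(\pi)}n(\sigma),\qquad \widehat V(\pi)=\sum_{\sigma\in X(\pi)}\frac{n_+(\sigma)}{n(\sigma)}\rho(\sigma),\qquad \beta(m,\delta')=\sqrt{\tfrac{8}{3m}\ln\tfrac1{\delta'}},$$ $$\mathrm{ucb}(\pi,\delta')=\widehat V(\pi)+\beta(n(\pi),\delta'),\qquad \mathrm{lcb}(\pi,\delta')=\min\{\widehat V(\pi),1\}-\beta(n(\pi),\delta').$$ Given $\epsilon,\delta\in(0,1)$, the algorithm Lucb-T, starting with no episodes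 played, does the following in batches $t=1,2,\dots$, with $\delta_L(t)=\dfrac{\delta}{3|\Pi|t^{|\Sigma|+4}}$. If $n(\sigma)=0$ for some $\sigma\in\Sigma$, it plays, for one episode, an arbitrary policy consistent with such a $\sigma$. Otherwise it picks $\pi_1\in\arg\max_{\pi\in\Pi}\widehat V(\pi)$ and $\pi_2\in\arg\max_{\pi\in\Pi\setminus\{\pi_1\}}\mathrm{ucb}(\pi,\delta_L(t))$; if $\mathrm{lcb}(\pi_1,\delta_L(t))\ge\mathrm{ucb}(\pi_2,\delta_L(t))-\epsilon$ it stops and returns $\pi_1$, and otherwise it plays $\pi_1$ and $\pi_2$ for one episode each. Then it updates the counts and goes to the next batch. Arbitrary choices and ties may be resolved in any way depending on the past, possibly at random. \textbf{Proposition.} For every such T-MDP, all $\epsilon,\delta\in(0,1)$, every way of resolving the arbitrary choices and every optimal policy $\pi^\star$, the probability that Lucb-T returns a policy $\pi\in\Pi$ with $V(\pi)<V(\pi^\star)-\epsilon$ is at most $\delta$. -/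

import Mathlib

open MeasureTheory ProbabilityTheory

/-- A finite tree Markov decision problem with non-terminal states `S`, terminal states `T` and
actions `A`. The tree is given by the map `parent`: every state `x` other than the start state has
exactly one parent `s` and is reachable from `s` by exactly one action `a`, where
`parent x = (s, a)`. Tree edges of probability zero are allowed. -/
structure TreeMDP (S T A : Type*) where
  /-- the start state -/
  start : S
  /-- the horizon -/
  H : ℕ
  one_le_H : 1 ≤ H
  /-- the discount factor -/
  γ : ℝ
  γ_nonneg : 0 ≤ γ
  γ_le_one : γ ≤ 1
  /-- `p s a` is the distribution of the next state on taking action `a` in state `s` -/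
  p : S → A → PMF (S ⊕ T)
  /-- `r s a x` is the reward for the transition from `s` to `x` by action `a` -/
  r : S → A → S ⊕ T → ℝ
  /-- the parent state, and the action leading from it -/
  parent : {x : S ⊕ T // x ≠ Sum.inl start} → S × A
  /-- the level of a non-terminal state -/
  level : S → ℕ
  level_start : level start = 1
  level_child : ∀ (s : S) (hs : Sum.inl s ≠ Sum.inl start),
    level s = level (parent ⟨Sum.inl s, hs⟩).1 + 1
  level_le : ∀ s, level s ≤ H
  /-- transitions go from a state to its children in the tree -/
  child_of_p_ne_zero : ∀ s a x, p s a x ≠ 0 → ∃ hx : x ≠ Sum.inl start, parent ⟨x, hx⟩ = (s, a)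

namespace TreeMDP

variable {S T A : Type*} (M : TreeMDP S T A)

/-- A positive-probability transition to a non-terminal state goes one level up. -/
theorem level_of_p_ne_zero {s s' : S} {a : A} (h : M.p s a (Sum.inl s') ≠ 0) :
    M.level s' = M.level s + 1 := by
  obtain ⟨hx, hp⟩ := M.child_of_p_ne_zero s a _ h
  rw [M.level_child s' hx, hp]

/-- Depth of a state in the tree, an auxiliary measure for recursion along the path. -/
def depth (x : S ⊕ T) : ℕ := Sum.elim M.level (fun _ => M.H + 1) x

theorem depth_parent_lt (x : S ⊕ T) (hx : x ≠ Sum.inl M.start) :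
    M.depth (Sum.inl (M.parent ⟨x, hx⟩).1) < M.depth x := by
  rcases x with s | σ
  · simp only [depth, Sum.elim_inl]
    rw [M.level_child s hx]
    exact Nat.lt_succ_self _
  · simpa only [depth, Sum.elim_inl, Sum.elim_inr] using Nat.lt_succ_of_le (M.level_le _)

open Classical in
/-- The path from the start state to `x`, as the list of its transitions
`(s₁, a₁, s₂), (s₂, a₂, s₃), …, (sₘ, aₘ, x)`. -/
noncomputable def path (x : S ⊕ T) : List (S × A × (S ⊕ T)) :=
  if hx : x = Sum.inl M.start then []
  else path (Sum.inl (M.parent ⟨x, hx⟩).1) ++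
    [((M.parent ⟨x, hx⟩).1, (M.parent ⟨x, hx⟩).2, x)]
termination_by M.depth x
decreasing_by exact M.depth_parent_lt x hx

/-- The return `ρ(σ)`: the discounted cumulative reward along the path to `σ`. -/
noncomputable def ret (σ : T) : ℝ :=
  ∑ i : Fin (M.path (Sum.inr σ)).length,
    M.γ ^ (i : ℕ) * M.r ((M.path (Sum.inr σ)).get i).1 ((M.path (Sum.inr σ)).get i).2.1
      ((M.path (Sum.inr σ)).get i).2.2

/-- The policy `π` is consistent with the terminal state `σ`: it takes the action following each
state in the path to `σ`. -/
def Consistent (π : S → A) (σ : T) : Prop :=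
  ∀ e ∈ M.path (Sum.inr σ), π e.1 = e.2.1

/-- The value `V^π(s)`, computed bottom-up; `value_bellman` is the Bellman equation. -/
noncomputable def value [Fintype S] [Fintype T] (π : S → A) (s : S) : ℝ :=
  open Classical in
  ∑ x : S ⊕ T, (M.p s (π s) x).toReal * (M.r s (π s) x + M.γ *
    (match x with
      | Sum.inl s' => if _h : M.p s (π s) (Sum.inl s') = 0 then 0 else value π s'
      | Sum.inr _ => 0))
termination_by M.H - M.level s
decreasing_by
  have h1 := M.level_of_p_ne_zero _h
  have h2 := M.level_le s'
  omega

/-- The right-hand side of the Bellman equation for taking action `a` in state `s` and following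
`π` afterwards; terminal states have value `0`. -/
noncomputable def backup [Fintype S] [Fintype T] (π : S → A) (s : S) (a : A) : ℝ :=
  ∑ x : S ⊕ T, (M.p s a x).toReal *
    (M.r s a x + M.γ * Sum.elim (fun s' => M.value π s') (fun _ => 0) x)

theorem value_bellman [Fintype S] [Fintype T] (π : S → A) (s : S) :
    M.value π s = M.backup π s (π s) := by
  rw [value, backup]
  refine Finset.sum_congr rfl fun x _ => ?_
  rcases x with s' | σ
  · by_cases h : M.p s (π s) (Sum.inl s') = 0
    · simp [h]
    · simp [h]
  · simp

/-- A policy is optimal if it maximises the right-hand side of the Bellman equation at every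
state. -/
def IsOptimal [Fintype S] [Fintype T] (π : S → A) : Prop :=
  ∀ s a, M.backup π s a ≤ M.backup π s (π s)

/-- The value `V(π)` of the policy `π` at the start state. -/
noncomputable def V [Fintype S] [Fintype T] (π : S → A) : ℝ := M.value π M.start

/-- The distribution of the terminal state reached from `s` by following `π`. -/
noncomputable def episodeFrom (π : S → A) (s : S) : PMF T :=
  (M.p s (π s)).bindOnSupport fun x hx =>
    match x, hx with
    | Sum.inl s', _hx => episodeFrom π s'
    | Sum.inr σ, _ => PMF.pure σ
termination_by M.H - M.level s
decreasing_by
  have h1 := M.level_of_p_ne_zero ((PMF.mem_support_iff _ _).1 _hx)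
  have h2 := M.level_le s'
  omega

/-- The distribution of the terminal state reached in one episode under `π`. By the tree property
the terminal state determines the trajectory. -/
noncomputable def episode (π : S → A) : PMF T := M.episodeFrom π M.start

open Classical in
/-- `X(π)`: the terminal states with which `π` is consistent. -/
noncomputable def X [Fintype T] (π : S → A) : Finset T :=
  Finset.univ.filter fun σ => M.Consistent π σ

theorem exists_consistent_of_path (π : S → A) (k : ℕ) (s : S) (hk : M.H ≤ M.level s + k)
    (hs : ∀ e ∈ M.path (Sum.inl s), π e.1 = e.2.1) : ∃ σ, M.Consistent π σ := by
  induction k generalizing s with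
  | zero =>
    obtain ⟨x, hx⟩ := (M.p s (π s)).support_nonempty
    obtain ⟨hx0, hp⟩ := M.child_of_p_ne_zero s (π s) x ((PMF.mem_support_iff _ _).1 hx)
    rcases x with s' | σ
    · have h1 := M.level_of_p_ne_zero ((PMF.mem_support_iff _ _).1 hx)
      have h2 := M.level_le s'
      omega
    · refine ⟨σ, fun e he => ?_⟩
      rw [path, dif_neg hx0, hp, List.mem_append, List.mem_singleton] at he
      rcases he with he | rfl
      · exact hs e he
      · rfl
  | succ k ih =>
    obtain ⟨x, hx⟩ := (M.p s (π s)).support_nonempty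
    obtain ⟨hx0, hp⟩ := M.child_of_p_ne_zero s (π s) x ((PMF.mem_support_iff _ _).1 hx)
    have key : ∀ e ∈ M.path x, π e.1 = e.2.1 := by
      intro e he
      rw [path, dif_neg hx0, hp, List.mem_append, List.mem_singleton] at he
      rcases he with he | rfl
      · exact hs e he
      · rfl
    rcases x with s' | σ
    · have h1 := M.level_of_p_ne_zero ((PMF.mem_support_iff _ _).1 hx)
      exact ih s' (by omega) key
    · exact ⟨σ, key⟩

theorem X_nonempty [Fintype T] (π : S → A) : (M.X π).Nonempty := by
  obtain ⟨σ, hσ⟩ := M.exists_consistent_of_path π M.H M.start (Nat.le_add_left _ _) (by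
    intro e he
    rw [path, dif_pos rfl] at he
    simp at he)
  exact ⟨σ, by simp [X, hσ]⟩

end TreeMDP

/-- A history: the list, in chronological order, of the policies played in the past episodes, each
with the terminal state that it reached. -/
abbrev PlayHistory (S T A : Type*) := List ((S → A) × T)

namespace TreeMDP

variable {S T A : Type*} (M : TreeMDP S T A)

open Classical in
/-- `n(σ)`: the number of past episodes on which the policy played was consistent with `σ`. -/
noncomputable def playCount (h : PlayHistory S T A) (σ : T) : ℕ :=
  h.countP fun e => decide (M.Consistent e.1 σ)

open Classical in
/-- `n₊(σ)`: the number of past episodes on which `σ` was reached. -/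
noncomputable def hitCount (h : PlayHistory S T A) (σ : T) : ℕ :=
  h.countP fun e => decide (e.2 = σ)

/-- `n(π)`: the least play count of a terminal state in `X(π)`. -/
noncomputable def policyCount [Fintype T] (h : PlayHistory S T A) (π : S → A) : ℕ :=
  (M.X π).inf' (M.X_nonempty π) (M.playCount h)

/-- The empirical value estimate of `π`; it is used only when all play counts are positive. -/
noncomputable def estimate [Fintype T] (h : PlayHistory S T A) (π : S → A) : ℝ :=
  ∑ σ ∈ M.X π, ((hitCount h σ : ℝ) / (M.playCount h σ : ℝ)) * M.ret σ

/-- The confidence width `β(m, δ)`, used only for `m ≥ 1`. -/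
noncomputable def confWidth (m : ℕ) (δ : ℝ) : ℝ := √(8 / (3 * (m : ℝ)) * Real.log (1 / δ))

/-- The upper confidence bound. -/
noncomputable def ucb [Fintype T] (h : PlayHistory S T A) (π : S → A) (δ : ℝ) : ℝ :=
  M.estimate h π + confWidth (M.policyCount h π) δ

/-- The lower confidence bound. -/
noncomputable def lcb [Fintype T] (h : PlayHistory S T A) (π : S → A) (δ : ℝ) : ℝ :=
  min (M.estimate h π) 1 - confWidth (M.policyCount h π) δ

/-- The mistake probability `δ_L(t) = δ / (3 |Π| t ^ (|Σ| + 4))` of batch `t`. -/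
noncomputable def deltaL (_M : TreeMDP S T A) (δ : ℝ) (t : ℕ) : ℝ :=
  δ / (3 * (Nat.card (S → A) : ℝ) * (t : ℝ) ^ (Nat.card T + 4))

/-- A resolution of the arbitrary choices of Lucb-T run with mistake probability `δ`: how it picks
the policy to play while some play count is zero, and how it breaks ties in the two maximisations
afterwards. The choices may depend on the batch `t` and the history `h`, and may be randomised. -/
structure LucbTRule [Fintype T] (M : TreeMDP S T A) (δ : ℝ) where
  /-- the policy played in batch `t` while some play count is zero -/
  initial : ℕ → PlayHistory S T A → PMF (S → A)
  initial_spec : ∀ t h, (∃ σ, M.playCount h σ = 0) →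
    ∀ π ∈ (initial t h).support, ∃ σ, M.playCount h σ = 0 ∧ M.Consistent π σ
  /-- the policies `(π₁, π₂)` identified in batch `t` once all play counts are positive -/
  pair : ℕ → PlayHistory S T A → PMF ((S → A) × (S → A))
  /-- `π₁` has the highest value estimate -/
  fst_spec : ∀ t h, (∀ σ, M.playCount h σ ≠ 0) →
    ∀ q ∈ (pair t h).support, ∀ π, M.estimate h π ≤ M.estimate h q.1
  /-- `π₂` has the highest upper confidence bound among the other policies -/
  snd_spec : ∀ t h, (∀ σ, M.playCount h σ ≠ 0) →
    ∀ q ∈ (pair t h).support, q.2 ≠ q.1 ∧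
      ∀ π, π ≠ q.1 → M.ucb h π (M.deltaL δ t) ≤ M.ucb h q.2 (M.deltaL δ t)

end TreeMDP

/-- The state of a run of Lucb-T at the beginning of a batch: still running with a given history,
or stopped with a returned policy. -/
inductive LucbTState (S T A : Type*) where
  | running : PlayHistory S T A → LucbTState S T A
  | returned : (S → A) → LucbTState S T A

instance {S T A : Type*} : MeasurableSpace (LucbTState S T A) := ⊤

namespace TreeMDP

variable {S T A : Type*} [Fintype T] (M : TreeMDP S T A)

open Classical in
/-- Batch `t` of Lucb-T with tolerance `ε` and mistake probability `δ`. -/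
noncomputable def lucbTBatch (ε δ : ℝ) (R : LucbTRule M δ) (t : ℕ) :
    LucbTState S T A → PMF (LucbTState S T A)
  | .returned π => PMF.pure (.returned π)
  | .running h =>
    if ∃ σ, M.playCount h σ = 0 then
      (R.initial t h).bind fun π =>
        (M.episode π).bind fun σ => PMF.pure (.running (h ++ [(π, σ)]))
    else
      (R.pair t h).bind fun q =>
        if M.lcb h q.1 (M.deltaL δ t) ≥ M.ucb h q.2 (M.deltaL δ t) - ε then
          PMF.pure (.returned q.1)
        else
          (M.episode q.1).bind fun σ₁ =>
            (M.episode q.2).bind fun σ₂ =>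
              PMF.pure (.running (h ++ [(q.1, σ₁), (q.2, σ₂)]))

/-- The Markov kernel from the states at times `0, …, n` to the state at time `n + 1`, which is the
state after batch `n + 1`. -/
noncomputable def lucbTKernel (ε δ : ℝ) (R : LucbTRule M δ) (n : ℕ) :
    Kernel ((_i : Finset.Iic n) → LucbTState S T A) (LucbTState S T A) where
  toFun x := (M.lucbTBatch ε δ R (n + 1) (x ⟨n, Finset.mem_Iic.2 le_rfl⟩)).toMeasure
  measurable' := (measurable_from_top
    (f := fun y : LucbTState S T A => (M.lucbTBatch ε δ R (n + 1) y).toMeasure)).comp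
      (measurable_pi_apply _)

instance (ε δ : ℝ) (R : LucbTRule M δ) (n : ℕ) : IsMarkovKernel (M.lucbTKernel ε δ R n) :=
  ⟨fun x => PMF.toMeasure.isProbabilityMeasure
    (M.lucbTBatch ε δ R (n + 1) (x ⟨n, Finset.mem_Iic.2 le_rfl⟩))⟩

/-- The law of the whole run of Lucb-T, started with the empty history. -/
noncomputable def lucbTLaw (ε δ : ℝ) (R : LucbTRule M δ) : Measure (ℕ → LucbTState S T A) :=
  Kernel.traj (X := fun _ => LucbTState S T A) (M.lucbTKernel ε δ R) 0
    (fun _ => LucbTState.running [])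

end TreeMDP

/-! If all confidence bounds hold in the batch that stops, then `V π* ≤ ucb π* ≤ ucb π₂ ≤ lcb π₁ + ε
≤ V π₁ + ε` (trivially so when `π* = π₁`). It remains to bound the probability that some bound ever
fails.

In a tree, an episode under a policy consistent with `σ` reaches `σ` with a probability `P(σ)`
(`pathProb`) that does not depend on the policy (`episode_apply`), so `V π = ∑ P(σ) ρ(σ)` over `X
π`. Hence for each fixed weight `u` the variable `exp (∑ (n₊(σ) u(σ) - n(σ) P(σ) (exp u(σ) - 1)))`
is a supermartingale however policies are chosen (`potential_supermartingale`), and Markov's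
inequality applies. With `u(σ) = θ ρ(σ) n(π) / n(σ)` on `X π` and zero elsewhere, it dominates `exp
(n(π) (θ (V̂ - V) - 2/3 θ²))` (`exp_le_expWeight`); choosing `θ = ± 3/4 β` turns a failed bound into
a value of at least `1 / δ_L`.

This `u` depends on the random play counts, so a union bound is taken over their possible values. On
`X π` the count depends only on the last state before `σ`, and since `|A| ≥ 2` there are at most
`|Σ| / 2` such states (`two_mul_card_lastStates_le`). With at most `2n` episodes before batch `n +
1`, at most `(2n + 1) ^ (|Σ| / 2) ≤ (n + 1) ^ |Σ|` count vectors arise. This is the power of `t` in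
`δ_L`; the remaining `t ^ 4` makes the sum over batches converge. -/

namespace TreeMDP

/-! ### Terminal distribution and value of a policy in the tree. -/

section Tree

variable {S T A : Type*} (M : TreeMDP S T A)

theorem path_start : M.path (Sum.inl M.start) = [] := by
  rw [path, dif_pos rfl]

theorem path_of_parent_eq {x : S ⊕ T} (hx : x ≠ Sum.inl M.start) {s : S} {a : A}
    (h : M.parent ⟨x, hx⟩ = (s, a)) : M.path x = M.path (Sum.inl s) ++ [(s, a, x)] := by
  rw [path, dif_neg hx, h]

theorem path_of_p_ne_zero {s : S} {a : A} {x : S ⊕ T} (h : M.p s a x ≠ 0) :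
    M.path x = M.path (Sum.inl s) ++ [(s, a, x)] := by
  obtain ⟨hx, hp⟩ := M.child_of_p_ne_zero s a x h
  exact M.path_of_parent_eq hx hp

/-- The distribution of the terminal state reached from `x` by following `π`. -/
noncomputable def terminalFrom (π : S → A) (x : S ⊕ T) : PMF T :=
  Sum.elim (M.episodeFrom π) PMF.pure x

theorem episodeFrom_eq_bind (π : S → A) (s : S) :
    M.episodeFrom π s = (M.p s (π s)).bind (M.terminalFrom π) := by
  rw [episodeFrom, ← PMF.bindOnSupport_eq_bind]
  congr 1
  funext x hx
  rcases x with s' | σ <;> rfl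

/-- Induction from the leaves of the tree to the root, along transitions of positive
probability. -/
theorem leaf_induction {P : S → Prop}
    (step : ∀ s, (∀ s' a, M.p s a (Sum.inl s') ≠ 0 → P s') → P s) (s : S) : P s := by
  suffices ∀ k s, M.H ≤ M.level s + k → P s from this M.H s (Nat.le_add_left _ _)
  intro k
  induction k with
  | zero =>
    intro s hs
    refine step s fun s' a h => ?_
    have h1 := M.level_of_p_ne_zero h
    have h2 := M.level_le s'
    omega
  | succ k ih =>
    intro s hs
    refine step s fun s' a h => ih s' ?_
    have h1 := M.level_of_p_ne_zero h
    omega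

/-- A terminal state reached from `s` under `π` lies below `s`, by a path following `π`. -/
theorem exists_path_append_of_episodeFrom_ne_zero (π : S → A) (s : S) (σ : T)
    (h : M.episodeFrom π s σ ≠ 0) :
    ∃ l, M.path (Sum.inr σ) = M.path (Sum.inl s) ++ l ∧ (∀ e ∈ l, π e.1 = e.2.1) ∧
      ∃ x, (s, π s, x) ∈ l := by
  induction s using M.leaf_induction with
  | step s ih =>
    rw [episodeFrom_eq_bind, ← PMF.mem_support_iff, PMF.mem_support_bind_iff] at h
    obtain ⟨x, hx, hσ⟩ := h
    rw [PMF.mem_support_iff] at hx hσ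
    have hpath := M.path_of_p_ne_zero hx
    rcases x with s' | τ
    · obtain ⟨l, hl, hc, -⟩ := ih s' _ hx hσ
      refine ⟨(s, π s, Sum.inl s') :: l, ?_, ?_, Sum.inl s', by simp⟩
      · rw [hl, hpath, List.append_assoc, List.singleton_append]
      · simpa using hc
    · have : σ = τ := by
        by_contra hne
        exact hσ (by simp [terminalFrom, hne])
      subst this
      exact ⟨[(s, π s, Sum.inr σ)], hpath, by simp, Sum.inr σ, by simp⟩

theorem path_prefix_of_terminalFrom_ne_zero (π : S → A) (x : S ⊕ T) (σ : T)
    (h : M.terminalFrom π x σ ≠ 0) : M.path x <+: M.path (Sum.inr σ) := by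
  rcases x with s | τ
  · obtain ⟨l, hl, -⟩ := M.exists_path_append_of_episodeFrom_ne_zero π s σ h
    exact ⟨l, hl.symm⟩
  · have : σ = τ := by
      by_contra hne
      exact h (by simp [terminalFrom, hne])
    rw [this]

/-- The product of the transition probabilities along the path to `x`. -/
noncomputable def pathProb (x : S ⊕ T) : ENNReal :=
  ((M.path x).map fun e => M.p e.1 e.2.1 e.2.2).prod

-- Factorisation of the episode probability at any node `x` on the path to `σ`, by induction along
-- that path; taking `x = σ` gives the policy-independent probability of reaching `σ`.
open Classical in
theorem episode_eq_mul_terminalFrom (π : S → A) (σ : T) (x : S ⊕ T)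
    (hx : M.path x <+: M.path (Sum.inr σ)) :
    M.episode π σ = (if ∀ e ∈ M.path x, π e.1 = e.2.1 then M.pathProb x else 0) *
      M.terminalFrom π x σ := by
  suffices ∀ k x, M.depth x < k → M.path x <+: M.path (Sum.inr σ) →
      M.episode π σ = (if ∀ e ∈ M.path x, π e.1 = e.2.1 then M.pathProb x else 0) *
        M.terminalFrom π x σ from this _ x (Nat.lt_succ_self _) hx
  intro k
  induction k with
  | zero => intro x hk; omega
  | succ k ih =>
    intro x hk hx
    by_cases h0 : x = Sum.inl M.start
    · subst h0
      simp [path_start, pathProb, terminalFrom, episode]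
    · obtain ⟨⟨s, a⟩, hp⟩ : ∃ q, M.parent ⟨x, h0⟩ = q := ⟨_, rfl⟩
      have hpath := M.path_of_parent_eq h0 hp
      have hd := M.depth_parent_lt x h0
      rw [hp] at hd
      have hs : M.path (Sum.inl s) <+: M.path (Sum.inr σ) :=
        List.IsPrefix.trans ⟨_, hpath.symm⟩ hx
      rw [ih (Sum.inl s) (by simp only at hd; omega) hs]
      -- The paths to `y` and to `x` are prefixes of the path to `σ` of equal length, hence equal;
      -- so only one term of the sum over successors of `s` survives.
      have huniq : ∀ y, M.p s (π s) y ≠ 0 → M.terminalFrom π y σ ≠ 0 → π s = a ∧ y = x := by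
        intro y hy hyσ
        have h1 := M.path_of_p_ne_zero hy
        have h2 := M.path_prefix_of_terminalFrom_ne_zero π y σ hyσ
        have h3 : M.path y = M.path x :=
          (List.prefix_of_prefix_length_le h2 hx (by rw [h1, hpath]; simp)).eq_of_length
            (by rw [h1, hpath]; simp)
        rw [h1, hpath] at h3
        simpa using h3
      have hK : M.terminalFrom π (Sum.inl s) σ =
          if π s = a then M.p s a x * M.terminalFrom π x σ else 0 := by
        change M.episodeFrom π s σ = _
        rw [episodeFrom_eq_bind, PMF.bind_apply]
        split_ifs with ha
        · rw [tsum_eq_single x, ha]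
          intro y hy
          by_contra hne
          exact hy (huniq y (left_ne_zero_of_mul hne) (right_ne_zero_of_mul hne)).2
        · rw [ENNReal.tsum_eq_zero]
          intro y
          by_contra hne
          exact ha (huniq y (left_ne_zero_of_mul hne) (right_ne_zero_of_mul hne)).1
      have hP : M.pathProb x = M.pathProb (Sum.inl s) * M.p s a x := by
        simp [pathProb, hpath]
      have hiff : (∀ e ∈ M.path x, π e.1 = e.2.1) ↔
          (∀ e ∈ M.path (Sum.inl s), π e.1 = e.2.1) ∧ π s = a := by
        rw [hpath]
        simp only [List.mem_append, List.mem_singleton]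
        constructor
        · exact fun h => ⟨fun e he => h e (Or.inl he), h (s, a, x) (Or.inr rfl)⟩
        · rintro ⟨h1, h2⟩ e (he | rfl)
          · exact h1 e he
          · exact h2
      rw [hK, hP]
      by_cases h1 : ∀ e ∈ M.path (Sum.inl s), π e.1 = e.2.1
      · by_cases h2 : π s = a
        · rw [if_pos h1, if_pos h2, if_pos (hiff.2 ⟨h1, h2⟩), mul_assoc]
        · rw [if_neg h2, if_neg fun h => h2 (hiff.1 h).2, mul_zero, zero_mul]
      · rw [if_neg h1, if_neg fun h => h1 (hiff.1 h).1, zero_mul, zero_mul]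

open Classical in
/-- An episode under `π` reaches `σ` with the probability of the path to `σ` if `π` is consistent
with `σ`, and never otherwise. -/
theorem episode_apply (π : S → A) (σ : T) :
    M.episode π σ = if M.Consistent π σ then M.pathProb (Sum.inr σ) else 0 := by
  rw [M.episode_eq_mul_terminalFrom π σ (Sum.inr σ) List.prefix_rfl]
  simp [terminalFrom, Consistent]

theorem sum_toReal_eq_one {α : Type*} [Fintype α] (q : PMF α) : ∑ x, (q x).toReal = 1 := by
  rw [← ENNReal.toReal_sum fun x _ => q.apply_ne_top x, ← tsum_fintype (L := .unconditional _),
    q.tsum_coe, ENNReal.toReal_one]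

/-- The discounted reward collected along a list of transitions. -/
noncomputable def listReturn (l : List (S × A × (S ⊕ T))) : ℝ :=
  ∑ i : Fin l.length, M.γ ^ (i : ℕ) * M.r (l.get i).1 (l.get i).2.1 (l.get i).2.2

theorem listReturn_append_singleton (l : List (S × A × (S ⊕ T))) (e : S × A × (S ⊕ T)) :
    M.listReturn (l ++ [e]) = M.listReturn l + M.γ ^ l.length * M.r e.1 e.2.1 e.2.2 := by
  have h : (l ++ [e]).length = l.length + 1 := by simp
  rw [listReturn, ← Equiv.sum_comp (finCongr h.symm), Fin.sum_univ_castSucc]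
  simp [listReturn]

section Value

variable [Fintype S] [Fintype T]

/-- Links the Bellman recursion to returns of whole paths: the reward collected before `s` is fixed,
and the future is discounted by the depth of `s`. -/
theorem sum_episodeFrom_mul_ret (π : S → A) (s : S) :
    ∑ σ, (M.episodeFrom π s σ).toReal * M.ret σ =
      M.listReturn (M.path (Sum.inl s)) +
        M.γ ^ (M.path (Sum.inl s)).length * M.value π s := by
  induction s using M.leaf_induction with
  | step s ih =>
    have h1 : ∀ σ, (M.episodeFrom π s σ).toReal =
        ∑ x, (M.p s (π s) x).toReal * (M.terminalFrom π x σ).toReal := by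
      intro σ
      rw [episodeFrom_eq_bind, PMF.bind_apply, tsum_fintype, ENNReal.toReal_sum]
      · simp [ENNReal.toReal_mul]
      · exact fun x _ => ENNReal.mul_ne_top (PMF.apply_ne_top _ _) (PMF.apply_ne_top _ _)
    have h2 : ∀ x, (M.p s (π s) x).toReal *
          ∑ σ, (M.terminalFrom π x σ).toReal * M.ret σ =
        (M.p s (π s) x).toReal * (M.listReturn (M.path (Sum.inl s)) +
          M.γ ^ (M.path (Sum.inl s)).length * (M.r s (π s) x +
            M.γ * Sum.elim (fun s' => M.value π s') (fun _ => 0) x)) := by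
      intro x
      by_cases hx : M.p s (π s) x = 0
      · simp [hx]
      have hpath := M.path_of_p_ne_zero hx
      have hlist := M.listReturn_append_singleton (M.path (Sum.inl s)) (s, π s, x)
      rw [← hpath] at hlist
      congr 1
      rcases x with s' | τ
      · have h3 := ih s' _ hx
        simp only [terminalFrom, Sum.elim_inl]
        rw [h3, hlist, hpath]
        simp only [List.length_append, List.length_singleton, pow_succ]
        ring
      · have h3 : ∑ σ, (M.terminalFrom π (Sum.inr τ) σ).toReal * M.ret σ = M.ret τ := by
          rw [Finset.sum_eq_single τ]
          · simp [terminalFrom]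
          · intro σ _ hne
            simp [terminalFrom, hne]
          · simp
        rw [h3]
        change M.listReturn (M.path (Sum.inr τ)) = _
        rw [hlist]
        simp
    calc ∑ σ, (M.episodeFrom π s σ).toReal * M.ret σ
        = ∑ x, (M.p s (π s) x).toReal *
            ∑ σ, (M.terminalFrom π x σ).toReal * M.ret σ := by
          simp_rw [h1, Finset.sum_mul, Finset.mul_sum, ← mul_assoc]
          exact Finset.sum_comm
      _ = _ := by
          simp_rw [h2]
          rw [value_bellman, backup, Finset.mul_sum]
          simp_rw [mul_add (M.p s (π s) _).toReal, Finset.sum_add_distrib, ← Finset.sum_mul]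
          rw [sum_toReal_eq_one, one_mul]
          congr 1
          exact Finset.sum_congr rfl fun x _ => by ring

theorem V_eq_sum_episode (π : S → A) : M.V π = ∑ σ, (M.episode π σ).toReal * M.ret σ := by
  rw [episode, sum_episodeFrom_mul_ret, path_start]
  simp [listReturn, V]

theorem V_eq_sum_X (π : S → A) :
    M.V π = ∑ σ ∈ M.X π, (M.pathProb (Sum.inr σ)).toReal * M.ret σ := by
  classical
  rw [V_eq_sum_episode, X, Finset.sum_filter]
  refine Finset.sum_congr rfl fun σ _ => ?_
  rw [episode_apply]
  split_ifs <;> simp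

theorem V_nonneg (hret : ∀ σ, M.ret σ ∈ Set.Icc (0 : ℝ) 1) (π : S → A) : 0 ≤ M.V π := by
  rw [V_eq_sum_episode]
  exact Finset.sum_nonneg fun σ _ => mul_nonneg ENNReal.toReal_nonneg (hret σ).1

theorem V_le_one (hret : ∀ σ, M.ret σ ∈ Set.Icc (0 : ℝ) 1) (π : S → A) : M.V π ≤ 1 := by
  rw [V_eq_sum_episode, ← sum_toReal_eq_one (M.episode π)]
  exact Finset.sum_le_sum fun σ _ => mul_le_of_le_one_right ENNReal.toReal_nonneg (hret σ).2

end Value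

/-! ### Counting the distinct play counts on `X π`. -/

/-- The last non-terminal state on the path to `σ`. -/
noncomputable def lastState (σ : T) : S := (M.parent ⟨Sum.inr σ, Sum.inr_ne_inl⟩).1

theorem consistent_iff (π : S → A) (σ : T) :
    M.Consistent π σ ↔ (∀ e ∈ M.path (Sum.inl (M.lastState σ)), π e.1 = e.2.1) ∧
      π (M.lastState σ) = (M.parent ⟨Sum.inr σ, Sum.inr_ne_inl⟩).2 := by
  have h := M.path_of_parent_eq (x := Sum.inr σ) Sum.inr_ne_inl
    (s := M.lastState σ) (a := (M.parent ⟨Sum.inr σ, Sum.inr_ne_inl⟩).2) rfl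
  rw [Consistent, h]
  simp only [List.mem_append, List.mem_singleton]
  constructor
  · exact fun h => ⟨fun e he => h e (Or.inl he), h _ (Or.inr rfl)⟩
  · rintro ⟨h1, h2⟩ e (he | rfl)
    · exact h1 e he
    · exact h2

/-- Both last actions are the one that `π` takes in the common last state, so exactly the same
policies are consistent with `σ` and with `τ`. -/
theorem playCount_eq_of_lastState_eq {π : S → A} {σ τ : T} (hσ : M.Consistent π σ)
    (hτ : M.Consistent π τ) (h : M.lastState σ = M.lastState τ) (hist : PlayHistory S T A) :
    M.playCount hist σ = M.playCount hist τ := by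
  have key : ∀ π', M.Consistent π' σ ↔ M.Consistent π' τ := by
    intro π'
    rw [consistent_iff] at hσ hτ
    rw [consistent_iff, consistent_iff, ← hσ.2, ← hτ.2, h]
  exact List.countP_congr fun e _ => by simp [key]

variable [Fintype T]

theorem mem_X {π : S → A} {σ : T} : σ ∈ M.X π ↔ M.Consistent π σ := by
  simp [X]

open Classical in
/-- The states in which an episode under `π` may end. -/
noncomputable def lastStates (π : S → A) : Finset S := (M.X π).image M.lastState

/-- Change the action of `π` at `s` only, and take any terminal state then reachable from `s`; the
path up to `s` still follows `π`. -/
theorem exists_terminal_deviating_at [Nontrivial A] (π : S → A) (s : S)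
    (hs : s ∈ M.lastStates π) :
    ∃ τ, (∃ e ∈ M.path (Sum.inr τ), e.1 = s ∧ π e.1 ≠ e.2.1) ∧
      ∀ e ∈ M.path (Sum.inr τ), e.1 ≠ s → π e.1 = e.2.1 := by
  classical
  obtain ⟨σ, hσ, rfl⟩ := Finset.mem_image.1 hs
  rw [mem_X, consistent_iff] at hσ
  set s := M.lastState σ
  obtain ⟨b, hb⟩ := exists_ne (π s)
  obtain ⟨τ, hτ⟩ := (M.episodeFrom (Function.update π s b) s).support_nonempty
  obtain ⟨l, hl, hc, x, hx⟩ := M.exists_path_append_of_episodeFrom_ne_zero _ s τ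
    ((PMF.mem_support_iff _ _).1 hτ)
  refine ⟨τ, ⟨_, hl ▸ List.mem_append_right _ hx, rfl, by simpa using hb.symm⟩, ?_⟩
  intro e he hne
  rw [hl, List.mem_append] at he
  rcases he with he | he
  · exact hσ.1 e he
  · simpa [Function.update_of_ne hne] using hc e he

/-- The last states inject into the complement of `X π` by the deviating terminal states, as `s` is
recovered as the only state of deviation. They are also an image of `X π`, so they number at most
half of `T`. -/
theorem two_mul_card_lastStates_le [Nontrivial A] (π : S → A) :
    2 * (M.lastStates π).card ≤ Fintype.card T := by
  classical
  have : Nonempty T := (M.X_nonempty π).to_type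
  choose! τ hτ using M.exists_terminal_deviating_at π
  have h1 : (M.lastStates π).card ≤ (M.X π).card := Finset.card_image_le
  have h2 : (M.lastStates π).card ≤ (M.X π)ᶜ.card := by
    refine Finset.card_le_card_of_injOn τ ?_ ?_
    · intro s hs
      obtain ⟨⟨e, he, -, hne⟩, -⟩ := hτ s hs
      rw [Finset.mem_coe, Finset.mem_compl, mem_X]
      exact fun hc => hne (hc e he)
    · intro s hs s' hs' heq
      obtain ⟨⟨e, he, rfl, hne⟩, -⟩ := hτ s hs
      by_contra h
      exact hne ((hτ s' hs').2 e (heq ▸ he) h)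
  have h3 := Finset.card_add_card_compl (M.X π)
  omega

end Tree

end TreeMDP

/-! ### Expectations under a `PMF` as sums in `ENNReal`. -/

section Expectation

variable {α β : Type*}

theorem PMF.tsum_pure_mul (a : α) (g : α → ENNReal) : ∑' y, PMF.pure a y * g y = g a := by
  rw [tsum_eq_single a]
  · simp
  · intro b hb
    simp [hb]

theorem PMF.tsum_bind_mul (p : PMF α) (f : α → PMF β) (g : β → ENNReal) :
    ∑' y, p.bind f y * g y = ∑' x, p x * ∑' y, f x y * g y := by
  simp_rw [PMF.bind_apply, ← ENNReal.tsum_mul_right, ← ENNReal.tsum_mul_left, mul_assoc]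
  exact ENNReal.tsum_comm

theorem PMF.tsum_mul_le (p : PMF α) {g : α → ENNReal} {c : ENNReal}
    (h : ∀ x ∈ p.support, g x ≤ c) : ∑' x, p x * g x ≤ c := by
  calc ∑' x, p x * g x ≤ ∑' x, p x * c := by
        refine ENNReal.tsum_le_tsum fun x => ?_
        by_cases hx : p x = 0
        · simp [hx]
        · exact mul_le_mul_right (h x ((PMF.mem_support_iff _ _).2 hx)) _
    _ = c := by rw [ENNReal.tsum_mul_right, p.tsum_coe, one_mul]

end Expectation

/-! ### The law of the run and its one-batch transitions. -/

instance {S T A : Type*} [Finite S] [Countable T] [Countable A] :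
    Countable (LucbTState S T A) := by
  let f : LucbTState S T A → PlayHistory S T A ⊕ (S → A) := fun x =>
    match x with
    | .running h => Sum.inl h
    | .returned π => Sum.inr π
  refine Function.Injective.countable (f := f) ?_
  rintro (h | π) (h' | π') heq <;> simp_all [f]

namespace TreeMDP

variable {S T A : Type*} [Fintype T] (M : TreeMDP S T A)

instance : DiscreteMeasurableSpace (LucbTState S T A) := ⟨fun _ => trivial⟩

instance (ε δ : ℝ) (R : LucbTRule M δ) : IsProbabilityMeasure (M.lucbTLaw ε δ R) := by
  unfold lucbTLaw
  infer_instance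

/-- The Markov property in integrated form. Countability of the state space turns the kernel
integral into a sum, so later arguments need only the `PMF` of a batch. -/
theorem lintegral_lucbTLaw_succ [Finite S] [Finite A] (ε δ : ℝ) (R : LucbTRule M δ) (n : ℕ)
    (F : LucbTState S T A → LucbTState S T A → ENNReal) :
    ∫⁻ ω, F (ω n) (ω (n + 1)) ∂M.lucbTLaw ε δ R =
      ∫⁻ ω, ∑' y, M.lucbTBatch ε δ R (n + 1) (ω n) y * F (ω n) y ∂M.lucbTLaw ε δ R := by
  have hF : Measurable (Function.uncurry F) := Measurable.of_discrete
  have hG : Measurable fun x : (_i : Finset.Iic n) → LucbTState S T A =>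
      ∑' y, M.lucbTBatch ε δ R (n + 1) (x ⟨n, Finset.mem_Iic.2 le_rfl⟩) y *
        F (x ⟨n, Finset.mem_Iic.2 le_rfl⟩) y :=
    (measurable_from_top (f := fun x => ∑' y, M.lucbTBatch ε δ R (n + 1) x y * F x y)).comp
      (measurable_pi_apply _)
  have hF' : Measurable fun x : (_i : Finset.Iic (n + 1)) → LucbTState S T A =>
      F (x ⟨n, Finset.mem_Iic.2 (Nat.le_succ n)⟩) (x ⟨n + 1, Finset.mem_Iic.2 le_rfl⟩) :=
    hF.comp (Measurable.prodMk (f := fun x : (_i : Finset.Iic (n + 1)) → LucbTState S T A =>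
      x ⟨n, Finset.mem_Iic.2 (Nat.le_succ n)⟩) (measurable_pi_apply _) (measurable_pi_apply _))
  have hmap := fun m => Kernel.traj_map_frestrictLe_apply (X := fun _ => LucbTState S T A)
    (κ := M.lucbTKernel ε δ R) 0 m (fun _ => LucbTState.running [])
  calc ∫⁻ ω, F (ω n) (ω (n + 1)) ∂M.lucbTLaw ε δ R
      = ∫⁻ x, F (x ⟨n, Finset.mem_Iic.2 (Nat.le_succ n)⟩) (x ⟨n + 1, Finset.mem_Iic.2 le_rfl⟩)
          ∂(Kernel.partialTraj (X := fun _ => LucbTState S T A) (M.lucbTKernel ε δ R) 0 (n + 1)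
            (fun _ => LucbTState.running [])) := by
        rw [← hmap, lintegral_map hF' (by fun_prop)]
        rfl
    _ = ∫⁻ x, ∑' y, M.lucbTBatch ε δ R (n + 1) (x ⟨n, Finset.mem_Iic.2 le_rfl⟩) y *
            F (x ⟨n, Finset.mem_Iic.2 le_rfl⟩) y
          ∂(Kernel.partialTraj (X := fun _ => LucbTState S T A) (M.lucbTKernel ε δ R) 0 n
            (fun _ => LucbTState.running [])) := by
        rw [Kernel.partialTraj_succ_eq_comp (Nat.zero_le n), Kernel.lintegral_comp _ _ _ hF']
        refine lintegral_congr fun x => ?_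
        rw [Kernel.partialTraj_succ_self, Kernel.lintegral_map _ (by fun_prop) _ hF',
          Kernel.lintegral_id_prod, Kernel.lintegral_map _ (by fun_prop),
          lintegral_countable']
        · refine tsum_congr fun y => ?_
          rw [mul_comm]
          congr 1
          · exact PMF.toMeasure_apply_singleton _ _ (measurableSet_singleton _)
          · simp [IicProdIoc_def, MeasurableEquiv.piSingleton]
        all_goals fun_prop
    _ = _ := by
        rw [← hmap, lintegral_map hG (by fun_prop)]
        rfl

theorem lintegral_lucbTLaw_zero (ε δ : ℝ) (R : LucbTRule M δ)
    (f : LucbTState S T A → ENNReal) :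
    ∫⁻ ω, f (ω 0) ∂M.lucbTLaw ε δ R = f (.running []) := by
  have hf : Measurable fun x : (_i : Finset.Iic 0) → LucbTState S T A =>
      f (x ⟨0, Finset.mem_Iic.2 le_rfl⟩) :=
    (measurable_from_top (f := f)).comp (measurable_pi_apply _)
  have hmap := Kernel.traj_map_frestrictLe_apply (X := fun _ => LucbTState S T A)
    (κ := M.lucbTKernel ε δ R) 0 0 (fun _ => LucbTState.running [])
  rw [Kernel.partialTraj_self, Kernel.id_apply] at hmap
  rw [← lintegral_dirac' (fun _ => LucbTState.running []) hf, ← hmap,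
    lintegral_map hf (by fun_prop)]
  rfl

/-- A function of the batch and the state whose conditional expectation does not increase has
expectation at most its initial value. -/
theorem lintegral_le_of_supermartingale [Finite S] [Finite A] (ε δ : ℝ) (R : LucbTRule M δ)
    (Φ : ℕ → LucbTState S T A → ENNReal)
    (hΦ : ∀ n x, ∑' y, M.lucbTBatch ε δ R (n + 1) x y * Φ (n + 1) y ≤ Φ n x) (n : ℕ) :
    ∫⁻ ω, Φ n (ω n) ∂M.lucbTLaw ε δ R ≤ Φ 0 (.running []) := by
  induction n with
  | zero => rw [lintegral_lucbTLaw_zero]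
  | succ n ih =>
    rw [M.lintegral_lucbTLaw_succ ε δ R n fun _ y => Φ (n + 1) y]
    exact (lintegral_mono fun ω : ℕ → LucbTState S T A => hΦ n (ω n)).trans ih

/-- If a batch started in a state satisfying `P` cannot end in a state satisfying `Q`, then almost
surely no batch does. -/
theorem ae_not_of_batch [Finite S] [Finite A] (ε δ : ℝ) (R : LucbTRule M δ) (n : ℕ)
    (P Q : LucbTState S T A → Prop)
    (h : ∀ x, P x → ∀ y ∈ (M.lucbTBatch ε δ R (n + 1) x).support, ¬ Q y) :
    ∀ᵐ (ω : ℕ → LucbTState S T A) ∂M.lucbTLaw ε δ R, P (ω n) → ¬ Q (ω (n + 1)) := by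
  classical
  -- The indicator of the forbidden transition has integral zero, hence vanishes almost surely.
  have h0 := M.lintegral_lucbTLaw_succ ε δ R n fun x y => if P x ∧ Q y then 1 else 0
  have h1 : ∀ x, ∑' y, M.lucbTBatch ε δ R (n + 1) x y *
      (if P x ∧ Q y then (1 : ENNReal) else 0) = 0 := by
    intro x
    rw [ENNReal.tsum_eq_zero]
    intro y
    by_cases hy : M.lucbTBatch ε δ R (n + 1) x y = 0
    · simp [hy]
    · have : ¬ (P x ∧ Q y) := fun hPQ => h x hPQ.1 y ((PMF.mem_support_iff _ _).2 hy) hPQ.2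
      simp [this]
  simp_rw [h1, lintegral_zero] at h0
  have hm : Measurable fun ω : ℕ → LucbTState S T A =>
      if P (ω n) ∧ Q (ω (n + 1)) then (1 : ENNReal) else 0 := by
    have : Measurable fun q : LucbTState S T A × LucbTState S T A =>
      if P q.1 ∧ Q q.2 then (1 : ENNReal) else 0 := Measurable.of_discrete
    exact this.comp (Measurable.prodMk (f := fun ω : ℕ → LucbTState S T A => ω n)
      (measurable_pi_apply _) (measurable_pi_apply _))
  rw [lintegral_eq_zero_iff hm] at h0
  filter_upwards [h0] with ω hω hP hQ
  simp [hP, hQ] at hω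

/-! ### The exponential supermartingale. -/

section Likelihood

/-- The exponential of the centred sum of the weights `u` of the terminal states reached. -/
noncomputable def expWeight (u : T → ℝ) (h : PlayHistory S T A) : ℝ :=
  Real.exp (∑ σ, ((hitCount h σ : ℝ) * u σ -
    (M.playCount h σ : ℝ) * ((M.pathProb (Sum.inr σ)).toReal * (Real.exp (u σ) - 1))))

theorem expWeight_nil (u : T → ℝ) : M.expWeight u [] = 1 := by
  simp [expWeight, hitCount, playCount]

-- An episode under `π` raises the play count of exactly the `σ` consistent with `π`, and for those
-- `P(σ)` is its probability of reaching `σ`. So the compensator grows by the mean of `exp u - 1`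
-- under the episode.
open Classical in
theorem expWeight_append_singleton (u : T → ℝ) (h : PlayHistory S T A) (π : S → A) (τ : T) :
    M.expWeight u (h ++ [(π, τ)]) = M.expWeight u h * (Real.exp (u τ) *
      Real.exp (-∑ σ, (M.episode π σ).toReal * (Real.exp (u σ) - 1))) := by
  rw [expWeight, expWeight, ← Real.exp_add, ← Real.exp_add]
  congr 1
  have h1 : ∀ σ, (hitCount (h ++ [(π, τ)]) σ : ℝ) = hitCount h σ + if τ = σ then 1 else 0 := by
    intro σ
    simp [hitCount, List.countP_append, List.countP_cons]
  have h2 : ∀ σ, (M.playCount (h ++ [(π, τ)]) σ : ℝ) * (M.pathProb (Sum.inr σ)).toReal =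
      M.playCount h σ * (M.pathProb (Sum.inr σ)).toReal + (M.episode π σ).toReal := by
    intro σ
    rw [episode_apply]
    by_cases hc : M.Consistent π σ <;>
      simp [playCount, List.countP_append, hc, add_mul]
  have h3 : u τ = ∑ σ, (if τ = σ then 1 else 0) * u σ := by simp
  rw [h3, ← Finset.sum_neg_distrib, ← Finset.sum_add_distrib, ← Finset.sum_add_distrib]
  refine Finset.sum_congr rfl fun σ _ => ?_
  rw [h1, ← mul_assoc, h2]
  ring

/-- With `ψ` the mean of `exp u - 1`, the expected growth factor is `(1 + ψ) exp (-ψ) ≤ 1`. -/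
theorem tsum_episode_mul_expWeight_le (u : T → ℝ) (h : PlayHistory S T A) (π : S → A) :
    ∑' τ, M.episode π τ * ENNReal.ofReal (M.expWeight u (h ++ [(π, τ)])) ≤
      ENNReal.ofReal (M.expWeight u h) := by
  have h0 : ∀ g, 0 ≤ M.expWeight u g := fun g => (Real.exp_pos _).le
  rw [tsum_fintype]
  have h1 : ∀ τ, M.episode π τ * ENNReal.ofReal (M.expWeight u (h ++ [(π, τ)])) =
      ENNReal.ofReal ((M.episode π τ).toReal * M.expWeight u (h ++ [(π, τ)])) := by
    intro τ
    rw [ENNReal.ofReal_mul ENNReal.toReal_nonneg, ENNReal.ofReal_toReal (PMF.apply_ne_top _ _)]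
  simp_rw [h1]
  rw [← ENNReal.ofReal_sum_of_nonneg fun τ _ => mul_nonneg ENNReal.toReal_nonneg (h0 _)]
  refine ENNReal.ofReal_le_ofReal ?_
  simp_rw [expWeight_append_singleton]
  set ψ := ∑ σ, (M.episode π σ).toReal * (Real.exp (u σ) - 1) with hψ
  have h2 : ∑ τ, (M.episode π τ).toReal * Real.exp (u τ) = ψ + 1 := by
    simp_rw [hψ, mul_sub, Finset.sum_sub_distrib, mul_one, sum_toReal_eq_one]
    ring
  calc ∑ τ, (M.episode π τ).toReal * (M.expWeight u h * (Real.exp (u τ) * Real.exp (-ψ)))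
      = M.expWeight u h * (Real.exp (-ψ) *
          ∑ τ, (M.episode π τ).toReal * Real.exp (u τ)) := by
        simp_rw [Finset.mul_sum]
        exact Finset.sum_congr rfl fun _ _ => by ring
    _ ≤ M.expWeight u h * (Real.exp (-ψ) * Real.exp ψ) := by
        rw [h2]
        exact mul_le_mul_of_nonneg_left (mul_le_mul_of_nonneg_left (Real.add_one_le_exp ψ)
          (Real.exp_pos _).le) (h0 _)
    _ = M.expWeight u h := by rw [← Real.exp_add]; simp

/-- The weight `expWeight` as a function of the state after batch `n`, infinite on the states that
cannot be reached because they contain too many episodes. -/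
noncomputable def potential (u : T → ℝ) (n : ℕ) : LucbTState S T A → ENNReal
  | .running h => if h.length ≤ 2 * n then ENNReal.ofReal (M.expWeight u h) else ⊤
  | .returned _ => 0

theorem potential_supermartingale (ε δ : ℝ) (R : LucbTRule M δ) (u : T → ℝ) (n : ℕ)
    (x : LucbTState S T A) :
    ∑' y, M.lucbTBatch ε δ R (n + 1) x y * M.potential u (n + 1) y ≤ M.potential u n x := by
  rcases x with h | π
  · by_cases hn : h.length ≤ 2 * n
    · have h1 : ∀ π τ, M.potential u (n + 1) (.running (h ++ [(π, τ)])) =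
          ENNReal.ofReal (M.expWeight u (h ++ [(π, τ)])) := by
        intro π τ
        rw [potential, if_pos]
        simp only [List.length_append, List.length_singleton]
        omega
      have h2 : ∀ q : (S → A) × (S → A), ∀ σ τ,
          M.potential u (n + 1) (.running (h ++ [(q.1, σ), (q.2, τ)])) =
          ENNReal.ofReal (M.expWeight u ((h ++ [(q.1, σ)]) ++ [(q.2, τ)])) := by
        intro q σ τ
        rw [potential, if_pos]
        · simp
        · simp only [List.length_append, List.length_cons, List.length_nil]
          omega
      rw [potential, if_pos hn, lucbTBatch]
      split_ifs with hc
      · rw [PMF.tsum_bind_mul]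
        refine PMF.tsum_mul_le _ fun π _ => ?_
        simp_rw [PMF.tsum_bind_mul, PMF.tsum_pure_mul, h1]
        exact M.tsum_episode_mul_expWeight_le u h π
      · rw [PMF.tsum_bind_mul]
        refine PMF.tsum_mul_le _ fun q _ => ?_
        split_ifs with hs
        · rw [PMF.tsum_pure_mul]
          simp [potential]
        · simp_rw [PMF.tsum_bind_mul, PMF.tsum_pure_mul, h2]
          -- Both policies are fixed before either episode, so the one-episode bound applies twice,
          -- to the second episode and then to the first.
          refine le_trans (ENNReal.tsum_le_tsum fun σ => mul_le_mul_right
            (M.tsum_episode_mul_expWeight_le u (h ++ [(q.1, σ)]) q.2) _) ?_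
          exact M.tsum_episode_mul_expWeight_le u h q.1
    · rw [potential, if_neg hn]
      exact le_top
  · rw [lucbTBatch, PMF.tsum_pure_mul]
    exact le_rfl

theorem measure_le_potential_le [Finite S] [Finite A] (ε δ : ℝ) (R : LucbTRule M δ) (u : T → ℝ)
    (n : ℕ) {d : ℝ} (hd : 0 < d) :
    M.lucbTLaw ε δ R {ω | ENNReal.ofReal (1 / d) ≤ M.potential u n (ω n)} ≤
      ENNReal.ofReal d := by
  have h1 := M.lintegral_le_of_supermartingale ε δ R (M.potential u)
    (M.potential_supermartingale ε δ R u) n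
  have h2 : M.potential u 0 (.running ([] : PlayHistory S T A)) = 1 := by
    simp [potential, expWeight_nil]
  rw [h2] at h1
  have hm : Measurable fun ω : ℕ → LucbTState S T A => M.potential u n (ω n) :=
    (measurable_from_top (f := M.potential u n)).comp (measurable_pi_apply _)
  refine (meas_ge_le_lintegral_div hm.aemeasurable (by simpa using hd)
    ENNReal.ofReal_ne_top).trans ?_
  rw [one_div, ENNReal.ofReal_inv_of_pos hd, ENNReal.div_eq_inv_mul, inv_inv]
  simpa using mul_le_mul_right h1 (ENNReal.ofReal d)

end Likelihood

end TreeMDP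

/-! ### From a failed confidence bound to a large exponential weight. -/

theorem Real.exp_sub_one_sub_le_of_abs_le {θ : ℝ} (h : |θ| ≤ 3 / 4) :
    Real.exp θ - 1 - θ ≤ 2 / 3 * θ ^ 2 := by
  -- The cubic remainder is at most `2/9 |θ|³ ≤ 1/6 θ²`, and `1/2 + 1/6 = 2/3`.
  have h1 := Real.exp_bound (x := θ) (h.trans (by norm_num)) (n := 3) (by norm_num)
  norm_num [Finset.sum_range_succ, Nat.factorial] at h1
  have h2 := (abs_le.1 h1).2
  have h3 : |θ| ^ 3 ≤ 3 / 4 * θ ^ 2 := by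
    rw [pow_succ, sq_abs, mul_comm]
    exact mul_le_mul_of_nonneg_right h (sq_nonneg θ)
  linarith

/-- Convexity: the exponential lies below its chord from `0` to `θ`. -/
theorem Real.exp_mul_sub_one_le {c : ℝ} (h0 : 0 ≤ c) (h1 : c ≤ 1) (θ : ℝ) :
    Real.exp (θ * c) - 1 ≤ c * (Real.exp θ - 1) := by
  have h := convexOn_exp.2 (Set.mem_univ (0 : ℝ)) (Set.mem_univ θ) (sub_nonneg.2 h1) h0
    (by ring)
  simp only [smul_eq_mul, mul_zero, zero_add, Real.exp_zero, mul_one] at h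
  rw [mul_comm θ]
  linarith

namespace TreeMDP

section Deviation

variable {S T A : Type*} [Fintype T] (M : TreeMDP S T A)

open Classical in
/-- The weights of the terminal states in the estimate of `π`, when their play counts are `c`. -/
noncomputable def estimateWeight (π : S → A) (c : T → ℕ) (θ : ℝ) (σ : T) : ℝ :=
  if σ ∈ M.X π then
    θ * (M.ret σ * ((M.X π).inf' (M.X_nonempty π) c : ℕ) / c σ)
  else 0

theorem estimateWeight_congr {π : S → A} {c c' : T → ℕ} (h : ∀ σ ∈ M.X π, c σ = c' σ) (θ : ℝ) :
    M.estimateWeight π c θ = M.estimateWeight π c' θ := by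
  funext σ
  rw [estimateWeight, estimateWeight, Finset.inf'_congr (M.X_nonempty π) rfl h]
  split_ifs with hσ
  · rw [h σ hσ]
  · rfl

theorem estimate_nonneg (hret : ∀ σ, M.ret σ ∈ Set.Icc (0 : ℝ) 1) (π : S → A)
    (h : PlayHistory S T A) : 0 ≤ M.estimate h π :=
  Finset.sum_nonneg fun σ _ =>
    mul_nonneg (div_nonneg (Nat.cast_nonneg _) (Nat.cast_nonneg _)) (hret σ).1

variable [Fintype S]

/-- The weights make the hit counts contribute exactly `θ m V̂`, with `m = n(π)`. As `ρ(σ) m / n(σ)`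
lies in `[0, 1]`, the chord bound reduces the compensator to at most `m V (exp θ - 1)`, and `V ≤ 1`
bounds its part beyond `m V θ`. -/
theorem exp_le_expWeight (hret : ∀ σ, M.ret σ ∈ Set.Icc (0 : ℝ) 1) (π : S → A)
    (h : PlayHistory S T A) (hpos : ∀ σ, M.playCount h σ ≠ 0) {θ : ℝ} (hθ : |θ| ≤ 3 / 4) :
    Real.exp (M.policyCount h π * (θ * (M.estimate h π - M.V π) - 2 / 3 * θ ^ 2)) ≤
      M.expWeight (M.estimateWeight π (M.playCount h) θ) h := by
  classical
  set m : ℝ := (M.policyCount h π : ℝ) with hm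
  have hm0 : 0 ≤ m := Nat.cast_nonneg _
  have hsum : ∀ σ ∈ M.X π,
      (hitCount h σ : ℝ) / M.playCount h σ * M.ret σ * (θ * m) -
        (M.pathProb (Sum.inr σ)).toReal * M.ret σ * (m * (Real.exp θ - 1)) ≤
      (hitCount h σ : ℝ) * M.estimateWeight π (M.playCount h) θ σ -
        (M.playCount h σ : ℝ) * ((M.pathProb (Sum.inr σ)).toReal *
          (Real.exp (M.estimateWeight π (M.playCount h) θ σ) - 1)) := by
    intro σ hσ
    have hn : (0 : ℝ) < M.playCount h σ := Nat.cast_pos.2 (Nat.pos_of_ne_zero (hpos σ))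
    have hmn : m ≤ M.playCount h σ := Nat.cast_le.2 (Finset.inf'_le _ hσ)
    have hu : M.estimateWeight π (M.playCount h) θ σ =
        θ * (M.ret σ * m / M.playCount h σ) := by
      rw [estimateWeight, if_pos hσ, hm, policyCount]
    have hc := Real.exp_mul_sub_one_le (c := M.ret σ * m / M.playCount h σ)
      (div_nonneg (mul_nonneg (hret σ).1 hm0) hn.le)
      ((div_le_one hn).2 ((mul_le_of_le_one_left hm0 (hret σ).2).trans hmn)) θ
    rw [← hu] at hc
    have h1 := mul_le_mul_of_nonneg_left hc
      (mul_nonneg hn.le (ENNReal.toReal_nonneg (a := M.pathProb (Sum.inr σ))))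
    have h2 : (M.playCount h σ : ℝ) * (M.pathProb (Sum.inr σ)).toReal *
        (M.ret σ * m / M.playCount h σ * (Real.exp θ - 1)) =
        (M.pathProb (Sum.inr σ)).toReal * M.ret σ * (m * (Real.exp θ - 1)) := by
      field_simp
    rw [h2] at h1
    have h3 : (hitCount h σ : ℝ) * M.estimateWeight π (M.playCount h) θ σ =
        (hitCount h σ : ℝ) / M.playCount h σ * M.ret σ * (θ * m) := by
      rw [hu]
      field_simp
    rw [h3]
    linarith
  have hall := Finset.sum_le_sum hsum
  rw [Finset.sum_sub_distrib, ← Finset.sum_mul, ← Finset.sum_mul, ← V_eq_sum_X, ← estimate]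
    at hall
  rw [expWeight, Real.exp_le_exp, ← Finset.sum_subset (Finset.subset_univ (M.X π))]
  · refine le_trans ?_ hall
    have h1 := Real.exp_sub_one_sub_le_of_abs_le hθ
    have h2 : M.V π * (Real.exp θ - 1 - θ) ≤ 2 / 3 * θ ^ 2 :=
      (mul_le_of_le_one_left (by linarith [Real.add_one_le_exp θ])
        (M.V_le_one hret π)).trans h1
    have h3 := mul_le_mul_of_nonneg_left h2 hm0
    linarith
  · intro σ _ hσ
    simp [estimateWeight, hσ]

/-- The exponent at which the deviation of the estimate is tested, in the direction `η`. -/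
noncomputable def testExponent (π : S → A) (c : T → ℕ) (d η : ℝ) : ℝ :=
  η * (3 / 4 * confWidth ((M.X π).inf' (M.X_nonempty π) c) d)

/-- The size `3/4 β` of `θ` maximises `|θ| β - 2/3 θ²`, with maximum `3/8 β²`; the constant `8/3` in
`confWidth` makes `m` times this equal to `log (1 / d)`. The hypothesis `β ≤ 1` gives `|θ| ≤ 3/4`.
-/
theorem one_div_le_expWeight (hret : ∀ σ, M.ret σ ∈ Set.Icc (0 : ℝ) 1) (π : S → A)
    (h : PlayHistory S T A) (hpos : ∀ σ, M.playCount h σ ≠ 0) {d : ℝ} (hd0 : 0 < d)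
    (hd1 : d < 1) {η : ℝ} (hη : |η| = 1) (hβ : confWidth (M.policyCount h π) d ≤ 1)
    (hdev : confWidth (M.policyCount h π) d ≤ η * (M.estimate h π - M.V π)) :
    1 / d ≤ M.expWeight (M.estimateWeight π (M.playCount h)
      (M.testExponent π (M.playCount h) d η)) h := by
  have ht : M.testExponent π (M.playCount h) d η =
      η * (3 / 4 * confWidth (M.policyCount h π) d) := rfl
  have hm : (0 : ℝ) < M.policyCount h π := by
    obtain ⟨σ, -, hσ⟩ := Finset.exists_mem_eq_inf' (M.X_nonempty π) (M.playCount h)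
    rw [policyCount, hσ]
    exact Nat.cast_pos.2 (Nat.pos_of_ne_zero (hpos σ))
  have hlog : 0 < Real.log (1 / d) := Real.log_pos ((one_lt_div hd0).2 hd1)
  have hβ0 : 0 ≤ confWidth (M.policyCount h π) d := Real.sqrt_nonneg _
  have hsq : M.policyCount h π * (3 / 8 * confWidth (M.policyCount h π) d ^ 2) =
      Real.log (1 / d) := by
    rw [confWidth, Real.sq_sqrt (by positivity)]
    field_simp
  rw [ht]
  set β := confWidth (M.policyCount h π) d
  have hη2 : η ^ 2 = 1 := by rw [← sq_abs, hη, one_pow]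
  refine le_trans ?_ (M.exp_le_expWeight hret π h hpos ?_)
  · rw [← Real.log_le_iff_le_exp (by positivity), ← hsq]
    refine mul_le_mul_of_nonneg_left ?_ hm.le
    have h1 := mul_le_mul_of_nonneg_left hdev hβ0
    have h2 : (η * (3 / 4 * β)) ^ 2 = 9 / 16 * β ^ 2 := by
      rw [mul_pow, hη2]
      ring
    rw [h2]
    linarith
  · rw [abs_mul, hη, one_mul, abs_of_nonneg (by positivity)]
    linarith

/-- If a confidence bound for `π` fails, then one of the two tests detects it. -/
theorem exists_one_div_le_expWeight (hret : ∀ σ, M.ret σ ∈ Set.Icc (0 : ℝ) 1) (π : S → A)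
    (h : PlayHistory S T A) (hpos : ∀ σ, M.playCount h σ ≠ 0) {d : ℝ} (hd0 : 0 < d)
    (hd1 : d < 1) (hfail : M.V π < M.lcb h π d ∨ M.ucb h π d < M.V π) :
    ∃ b : Bool, 1 / d ≤ M.expWeight (M.estimateWeight π (M.playCount h)
      (M.testExponent π (M.playCount h) d (cond b 1 (-1)))) h := by
  have h0 := M.V_nonneg hret π
  have h1 := M.V_le_one hret π
  have h2 := M.estimate_nonneg hret π h
  -- In both cases failure forces `β ≤ 1`: for `lcb` by its cap at `1` and `V ≥ 0`, for `ucb` by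
  -- nonnegativity of the estimate and `V ≤ 1`.
  rcases hfail with hf | hf
  · rw [lcb] at hf
    have h3 := min_le_left (M.estimate h π) 1
    have h4 := min_le_right (M.estimate h π) 1
    exact ⟨true, M.one_div_le_expWeight hret π h hpos hd0 hd1 (by simp) (by linarith)
      (by simp only [cond_true]; linarith)⟩
  · rw [ucb] at hf
    exact ⟨false, M.one_div_le_expWeight hret π h hpos hd0 hd1 (by simp) (by linarith)
      (by simp only [cond_false]; linarith)⟩

end Deviation

/-! ### Union bound over policies, count vectors, directions and batches. -/

section Union

variable {S T A : Type*} (M : TreeMDP S T A)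

theorem deltaL_mem_Ioo [Finite S] [Finite T] [Finite A] [Nonempty A] {δ : ℝ}
    (hδ : δ ∈ Set.Ioo (0 : ℝ) 1) (n : ℕ) :
    M.deltaL δ (n + 1) ∈ Set.Ioo (0 : ℝ) 1 := by
  have h1 : (1 : ℝ) ≤ Nat.card (S → A) := by
    exact_mod_cast Nat.one_le_iff_ne_zero.2 Nat.card_pos.ne'
  have h2 : (1 : ℝ) ≤ ((n + 1 : ℕ) : ℝ) ^ (Nat.card T + 4) :=
    one_le_pow₀ (by push_cast; linarith [n.cast_nonneg (α := ℝ)])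
  have h3 : 1 ≤ 3 * (Nat.card (S → A) : ℝ) * ((n + 1 : ℕ) : ℝ) ^ (Nat.card T + 4) :=
    one_le_mul_of_one_le_of_one_le (by linarith) h2
  exact ⟨div_pos hδ.1 (by linarith), (div_le_self hδ.1.le h3).trans_lt hδ.2⟩

variable [Fintype T]

open Classical in
/-- The play counts of the terminal states that are given by counts for their last states. -/
noncomputable def extendCount {n : ℕ} (π : S → A) (c : M.lastStates π → Fin n) (σ : T) : ℕ :=
  if h : M.lastState σ ∈ M.lastStates π then c ⟨M.lastState σ, h⟩ else 0

theorem exists_extendCount_eq {n : ℕ} (π : S → A) (h : PlayHistory S T A) (hn : h.length < n) :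
    ∃ c : M.lastStates π → Fin n, ∀ σ ∈ M.X π, M.playCount h σ = M.extendCount π c σ := by
  classical
  choose τ hτ using fun s : M.lastStates π => Finset.mem_image.1 s.2
  refine ⟨fun s => ⟨M.playCount h (τ s), lt_of_le_of_lt List.countP_le_length hn⟩,
    fun σ hσ => ?_⟩
  have hs : M.lastState σ ∈ M.lastStates π := Finset.mem_image_of_mem _ hσ
  rw [extendCount, dif_pos hs]
  exact M.playCount_eq_of_lastState_eq (M.mem_X.1 hσ) (M.mem_X.1 (hτ ⟨_, hs⟩).1)
    (hτ ⟨_, hs⟩).2.symm h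

/-- Some confidence bound fails in batch `n + 1`. -/
def BoundFails [Fintype S] (δ : ℝ) (n : ℕ) (x : LucbTState S T A) : Prop :=
  ∃ h, x = .running h ∧ (∀ σ, M.playCount h σ ≠ 0) ∧
    ∃ π, M.V π < M.lcb h π (M.deltaL δ (n + 1)) ∨ M.ucb h π (M.deltaL δ (n + 1)) < M.V π

open Classical in
theorem card_counts_le [Nontrivial A] (π : S → A) (n : ℕ) :
    (Fintype.card (M.lastStates π → Fin (2 * n + 1)) : ℝ) ≤
      ((n + 1 : ℕ) : ℝ) ^ Nat.card T := by
  rw [Fintype.card_fun, Fintype.card_fin, Fintype.card_coe, Nat.card_eq_fintype_card]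
  norm_cast
  calc (2 * n + 1) ^ (M.lastStates π).card ≤ ((n + 1) ^ 2) ^ (M.lastStates π).card :=
        Nat.pow_le_pow_left (by nlinarith) _
    _ = (n + 1) ^ (2 * (M.lastStates π).card) := (pow_mul _ _ _).symm
    _ ≤ (n + 1) ^ Fintype.card T :=
        Nat.pow_le_pow_right (Nat.succ_pos n) (M.two_mul_card_lastStates_le π)

variable [Fintype S]

theorem measure_boundFails_le [Fintype A] [Nontrivial A] (hret : ∀ σ, M.ret σ ∈ Set.Icc (0 : ℝ) 1)
    (ε : ℝ) {δ : ℝ} (hδ : δ ∈ Set.Ioo (0 : ℝ) 1) (R : LucbTRule M δ) (n : ℕ) :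
    M.lucbTLaw ε δ R {ω | M.BoundFails δ n (ω n)} ≤
      ENNReal.ofReal (2 / 3 * δ * (1 / ((n + 1 : ℕ) : ℝ) ^ 4)) := by
  classical
  obtain ⟨hd0, hd1⟩ := M.deltaL_mem_Ioo hδ n
  set d := M.deltaL δ (n + 1) with hd
  -- Once the count vector `c` is fixed, the weight is no longer random, so Markov's inequality
  -- applies to each test separately.
  let u : (π : S → A) → (M.lastStates π → Fin (2 * n + 1)) → Bool → T → ℝ := fun π c b =>
    M.estimateWeight π (M.extendCount π c)
      (M.testExponent π (M.extendCount π c) d (cond b 1 (-1)))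
  have hsub : {ω : ℕ → LucbTState S T A | M.BoundFails δ n (ω n)} ⊆
      ⋃ π, ⋃ c, ⋃ b, {ω | ENNReal.ofReal (1 / d) ≤ M.potential (u π c b) n (ω n)} := by
    rintro ω ⟨h, hω, hpos, π, hfail⟩
    simp only [Set.mem_iUnion, Set.mem_ofPred_eq, hω, potential]
    refine ⟨π, ?_⟩
    by_cases hlen : h.length ≤ 2 * n
    · obtain ⟨c, hc⟩ := M.exists_extendCount_eq π h (Nat.lt_succ_of_le hlen)
      obtain ⟨b, hb⟩ := M.exists_one_div_le_expWeight hret π h hpos hd0 hd1 hfail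
      refine ⟨c, b, ?_⟩
      rw [if_pos hlen]
      refine ENNReal.ofReal_le_ofReal ?_
      convert hb using 2
      simp only [u]
      rw [M.estimateWeight_congr hc, testExponent, testExponent,
        Finset.inf'_congr (M.X_nonempty π) rfl hc]
    -- A history too long to occur has potential `⊤` and triggers every test, so any indices serve.
    · exact ⟨fun _ => 0, true, by rw [if_neg hlen]; exact le_top⟩
  calc M.lucbTLaw ε δ R {ω | M.BoundFails δ n (ω n)}
      ≤ ∑ π, ∑ c, ∑ b, M.lucbTLaw ε δ R
          {ω | ENNReal.ofReal (1 / d) ≤ M.potential (u π c b) n (ω n)} := by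
        refine (measure_mono hsub).trans ((measure_iUnion_fintype_le _ _).trans ?_)
        refine Finset.sum_le_sum fun π _ => (measure_iUnion_fintype_le _ _).trans ?_
        exact Finset.sum_le_sum fun c _ => measure_iUnion_fintype_le _ _
    _ ≤ ∑ π : S → A, ∑ _c : M.lastStates π → Fin (2 * n + 1), ∑ _b : Bool,
          ENNReal.ofReal d := by
        gcongr
        exact M.measure_le_potential_le ε δ R _ n hd0
    _ = ENNReal.ofReal (∑ π : S → A, ∑ _c : M.lastStates π → Fin (2 * n + 1), ∑ _b : Bool, d) := by
        rw [ENNReal.ofReal_sum_of_nonneg fun _ _ => by positivity]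
        refine Finset.sum_congr rfl fun π _ => ?_
        rw [ENNReal.ofReal_sum_of_nonneg fun _ _ => by positivity]
        refine Finset.sum_congr rfl fun c _ => ?_
        rw [ENNReal.ofReal_sum_of_nonneg fun _ _ => by positivity]
    _ ≤ ENNReal.ofReal (∑ _π : S → A, ((n + 1 : ℕ) : ℝ) ^ Nat.card T * (2 * d)) := by
        refine ENNReal.ofReal_le_ofReal (Finset.sum_le_sum fun π _ => ?_)
        simp only [Finset.sum_const, Finset.card_univ, nsmul_eq_mul, Fintype.card_bool,
          Nat.cast_ofNat]
        exact mul_le_mul_of_nonneg_right (M.card_counts_le π n) (by positivity)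
    -- The `2 |Π| (n + 1) ^ |Σ|` tests at level `δ_L(n + 1)` leave `2/3 δ / (n + 1) ^ 4`.
    _ = _ := by
        congr 1
        rw [Finset.sum_const, Finset.card_univ, nsmul_eq_mul, hd, deltaL,
          ← Nat.card_eq_fintype_card, pow_add]
        have h1 : (Nat.card (S → A) : ℝ) ≠ 0 := Nat.cast_ne_zero.2 Nat.card_pos.ne'
        have h2 : ((n + 1 : ℕ) : ℝ) ≠ 0 := Nat.cast_ne_zero.2 n.succ_ne_zero
        field_simp

/-- The sum is `2/3 δ ζ(4)`, and `ζ(4) = π⁴ / 90 < 3/2`. -/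
theorem tsum_boundFails_le {δ : ℝ} (hδ : 0 ≤ δ) :
    ∑' n : ℕ, ENNReal.ofReal (2 / 3 * δ * (1 / ((n + 1 : ℕ) : ℝ) ^ 4)) ≤ ENNReal.ofReal δ := by
  have hz : HasSum (fun n : ℕ => (1 : ℝ) / ((n + 1 : ℕ) : ℝ) ^ 4) (Real.pi ^ 4 / 90) := by
    simpa using (hasSum_nat_add_iff' (f := fun n : ℕ => (1 : ℝ) / (n : ℝ) ^ 4) 1).2
      hasSum_zeta_four
  have hs := hz.mul_left (2 / 3 * δ)
  rw [← ENNReal.ofReal_tsum_of_nonneg (fun n => by positivity) hs.summable, hs.tsum_eq]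
  refine ENNReal.ofReal_le_ofReal ?_
  have hpi : Real.pi ^ 4 ≤ 3.15 ^ 4 := pow_le_pow_left₀ Real.pi_pos.le Real.pi_lt_d2.le 4
  norm_num at hpi
  nlinarith

/-- In a batch in which all confidence bounds hold, no suboptimal policy is returned. -/
theorem not_returned_of_not_boundFails {ε δ : ℝ} (hε : 0 < ε) (R : LucbTRule M δ)
    (πstar : S → A) (n : ℕ) (x y : LucbTState S T A) (hx : ¬ M.BoundFails δ n x)
    (hx' : ¬ ∃ π, x = .returned π ∧ M.V π < M.V πstar - ε)
    (hy : y ∈ (M.lucbTBatch ε δ R (n + 1) x).support) :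
    ¬ ∃ π, y = .returned π ∧ M.V π < M.V πstar - ε := by
  rcases x with h | π
  · rw [lucbTBatch] at hy
    split_ifs at hy with hc
    · simp only [PMF.mem_support_bind_iff, PMF.mem_support_pure_iff] at hy
      obtain ⟨_, _, _, _, rfl⟩ := hy
      simp
    · push Not at hc
      rw [PMF.mem_support_bind_iff] at hy
      obtain ⟨q, hq, hy⟩ := hy
      split_ifs at hy with hs
      · rw [PMF.mem_support_pure_iff] at hy
        subst hy
        rintro ⟨π, heq, hlt⟩
        cases heq
        have hb : ∀ π, M.lcb h π (M.deltaL δ (n + 1)) ≤ M.V π ∧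
            M.V π ≤ M.ucb h π (M.deltaL δ (n + 1)) := by
          intro π
          by_contra hcon
          rw [not_and_or, not_le, not_le] at hcon
          exact hx ⟨h, rfl, hc, π, hcon⟩
        -- The maximality of `π₂` covers only policies other than `π₁`.
        by_cases heq : πstar = q.1
        · rw [← heq] at hlt
          linarith
        · have h1 := (R.snd_spec (n + 1) h hc q hq).2 πstar heq
          have h2 := (hb q.1).1
          have h3 := (hb πstar).2
          linarith
      · simp only [PMF.mem_support_bind_iff, PMF.mem_support_pure_iff] at hy
        obtain ⟨_, _, _, _, rfl⟩ := hy
        simp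
  · rw [lucbTBatch, PMF.mem_support_pure_iff] at hy
    rwa [hy]

end Union

end TreeMDP

theorem mainTheorem4 {S T A : Type*} [Fintype S] [Fintype T] [Fintype A] [Nontrivial A]
    (M : TreeMDP S T A) (hret : ∀ σ, M.ret σ ∈ Set.Icc (0 : ℝ) 1)
    (ε δ : ℝ) (hε : ε ∈ Set.Ioo (0 : ℝ) 1) (hδ : δ ∈ Set.Ioo (0 : ℝ) 1)
    (R : M.LucbTRule δ) (πstar : S → A) (hstar : M.IsOptimal πstar) :
    M.lucbTLaw ε δ R
        {ω | ∃ n π, ω n = LucbTState.returned π ∧ M.V π < M.V πstar - ε} ≤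
      ENNReal.ofReal δ := by
  classical
  let Q : LucbTState S T A → Prop := fun x =>
    ∃ π, x = LucbTState.returned π ∧ M.V π < M.V πstar - ε
  have hstep : ∀ n, ∀ᵐ (ω : ℕ → LucbTState S T A) ∂M.lucbTLaw ε δ R,
      (¬ M.BoundFails δ n (ω n) ∧ ¬ Q (ω n)) → ¬ Q (ω (n + 1)) := fun n =>
    M.ae_not_of_batch ε δ R n (fun x => ¬ M.BoundFails δ n x ∧ ¬ Q x) Q fun x hx y hy =>
      M.not_returned_of_not_boundFails hε.1 R πstar n x y hx.1 hx.2 hy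
  have hzero : ∀ᵐ (ω : ℕ → LucbTState S T A) ∂M.lucbTLaw ε δ R, ¬ Q (ω 0) := by
    have h0 := M.lintegral_lucbTLaw_zero ε δ R fun x => if Q x then 1 else 0
    have hm : Measurable fun ω : ℕ → LucbTState S T A => if Q (ω 0) then (1 : ENNReal) else 0 :=
      (measurable_from_top (f := fun x => if Q x then (1 : ENNReal) else 0)).comp
        (measurable_pi_apply _)
    rw [if_neg (by simp [Q]), lintegral_eq_zero_iff hm] at h0
    filter_upwards [h0] with ω hω hQ
    simp [hQ] at hω
  -- Along almost every run without a failed bound, induction over the batches shows that no bad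
  -- policy is ever returned.
  have hae : ({ω : ℕ → LucbTState S T A | ∃ n π, ω n = LucbTState.returned π ∧
      M.V π < M.V πstar - ε} : Set (ℕ → LucbTState S T A)) ≤ᵐ[M.lucbTLaw ε δ R]
      ⋃ n, {ω | M.BoundFails δ n (ω n)} := by
    filter_upwards [ae_all_iff.2 hstep, hzero] with ω h1 h0 hω
    obtain ⟨n, hn⟩ : ∃ n, Q (ω n) := hω
    by_contra hcon
    have hcon' : ∀ k, ¬ M.BoundFails δ k (ω k) := fun k hk =>
      hcon (Set.mem_iUnion.2 ⟨k, hk⟩)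
    have hall : ∀ k, ¬ Q (ω k) := by
      intro k
      induction k with
      | zero => exact h0
      | succ k ih => exact h1 k ⟨hcon' k, ih⟩
    exact hall n hn
  calc _ ≤ M.lucbTLaw ε δ R (⋃ n, {ω | M.BoundFails δ n (ω n)}) := measure_mono_ae hae
    _ ≤ ∑' n, M.lucbTLaw ε δ R {ω | M.BoundFails δ n (ω n)} := measure_iUnion_le _
    _ ≤ ∑' n : ℕ, ENNReal.ofReal (2 / 3 * δ * (1 / ((n + 1 : ℕ) : ℝ) ^ 4)) :=
        ENNReal.tsum_le_tsum fun n => M.measure_boundFails_le hret ε hδ R n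
    _ ≤ ENNReal.ofReal δ := TreeMDP.tsum_boundFails_le hδ.1.le
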